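/- Let $p$ be an odd prime, let $n_1$ be a positive integer coprime to $p$, let $m$ be the least positive integer with $p^m \equiv 1 \pmod{n_1}$, and let $q = p^m$. Let $\alpha$ be a primitive element of $\mathbb{F}_q$ and put $$N = \frac{q-1}{n_1}, \qquad N_1 = \gcd\Big(N, \frac{q-1}{p-1}\Big), \qquad \theta = \alpha^N .$$ Let $D = \{\theta^i : 0 \le i < n_1\}$ and let $$C_D = \{(\mathrm{Tr}(a), \mathrm{Tr}(a\theta), \ldots, \mathrm{Tr}(a\theta^{n_1-1})) : a \in \mathbb{F}_q\} \subseteq \mathbb{F}_p^{n_1},$$ where $\mathrm{Tr}$ is the trace from $\mathbb{F}_q$ to $\mathbb{F}_p$. For a linear code $C \subseteq \mathbb{F}_p^n$ and $1 \le r \le \dim C$, let $d_r(C)$ denote its $r$-th generalized Hamming weight, that is, the minimum of $|\mathrm{Supp}(U)|$ over all $r$-dimensional subspaces $U$ of $C$, where $\mathrm{Supp}(U)$ is the set of coordinates at which some vector of $U$ is nonzero. Suppose that $N_1 \ge 3$, that $j$ is the least positive integer such that $N_1 \mid p^j+1$, and that $q = p^{2j\gamma}$ for some integer $\gamma$. Then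 for every $r$ with $1 \le r \le j$ one has $r \le \dim C_D$ and $$d_r(C_D) = \begin{cases} \left(1-\dfrac{1}{p^r}\right)\dfrac{q-\sqrt q}{N}, & \text{if } \gamma \text{ is even},\\[2ex] \left(1-\dfrac{1}{p^r}\right)\dfrac{q-(N_1-1)\sqrt q}{N}, & \text{if } \gamma \text{ is odd}.\end{cases}$$ -/

import Mathlib

/-- The support of a subspace `U` of `K^ι`: the coordinates at which some vector of `U` is
nonzero. -/
def codeSupport {K ι : Type*} [Field K] (U : Submodule K (ι → K)) : Set ι :=
  {i | ∃ x ∈ U, x i ≠ 0}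

/-- The `r`-th generalized Hamming weight of a linear code `C` of finite length over `K`: the
minimum of `|Supp U|` over the `r`-dimensional subspaces `U` of `C`. It is meaningful for
`r ≤ dim C`, when the set below is nonempty, so that the infimum in `ℕ` is a minimum. -/
noncomputable def generalizedHammingWeight {K ι : Type*} [Field K]
    (C : Submodule K (ι → K)) (r : ℕ) : ℕ :=
  sInf {w : ℕ | ∃ U : Submodule K (ι → K),
    U ≤ C ∧ Module.finrank K U = r ∧ (codeSupport U).ncard = w}

/-- The `K`-linear map `a ↦ (Tr (a * d i))_i` from `F` to `K^ι`. -/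
noncomputable def traceCodeword (K : Type*) {F ι : Type*} [Field K] [Field F] [Algebra K F]
    (d : ι → F) : F →ₗ[K] (ι → K) :=
  LinearMap.pi fun i => Algebra.trace K F ∘ₗ LinearMap.mulRight K (d i)

/-- The trace code with defining set `{d i}`: `{(Tr (a * d i))_i : a ∈ F}`. -/
noncomputable def definingSetCode (K : Type*) {F ι : Type*} [Field K] [Field F] [Algebra K F]
    (d : ι → F) : Submodule K (ι → K) :=
  LinearMap.range (traceCodeword K d)

theorem traceCodeword_apply (K : Type*) {F ι : Type*} [Field K] [Field F] [Algebra K F]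
    (d : ι → F) (a : F) (i : ι) :
    traceCodeword K d a i = Algebra.trace K F (a * d i) := rfl

/-! Put Q = p^j, so q = Q^(2γ). The (q-1)/(p-1)-th powers of units form F_p^×, so N times the weight
of the codeword of a is the number of units y with Tr(a y^N₁) ≠ 0 (`traceNonzeroCount_gcd`). This
number is a decreasing affine function of the sum S(a) = Σ_y χ(a y^N₁) (`monomialSum_eq`).

As N₁ divides Q+1, S is an average of sums with exponent Q+1. Those are Hermitian: |S|² =
q·|radical| with a radical of size 1 or Q², and a congruence modulo Q+1 fixes the sign
(`monomialSum_hermitian`). Averaging gives two values of S, one of them on a single coset of the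
N₁-th powers (`monomialSum_semiprimitive`). The parity of γ decides which value is larger, hence the
minimum weight W; some coset b·(F^×)^N₁ attains it.

The support of an r-dimensional code U has size proportional to the total weight of U, so it is
smallest when every nonzero word has weight W (`generalizedHammingWeight_of_constant_weight`). Since
N₁(Q-1) divides q-1, all nonzero elements of F_Q are N₁-th powers. Hence b·F_Q, of dimension j, has
constant weight W, and its r-dimensional subspaces give d_r for all r ≤ j. -/

open Finset

/-! ### Finite groups: averaging, stable subsets, powers in cyclic groups. -/

/-- Averaging along a surjective homomorphism of finite groups. -/
theorem MonoidHom.card_mul_sum_comp {G H R : Type*} [Group G] [Group H] [Fintype G] [Fintype H]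
    [CommSemiring R] (φ : G →* H) (hφ : Function.Surjective φ) (f : H → R) :
    (Fintype.card H : R) * ∑ g, f (φ g) = Fintype.card G * ∑ h, f h := by
  classical
  have hfib : ∀ h, #{g | φ g = h} = #{g | φ g = 1} := fun h =>
    MonoidHom.card_fiber_eq_of_mem_range φ (hφ h) (hφ 1)
  have hcard : Fintype.card G = Fintype.card H * #{g | φ g = 1} := by
    rw [← Finset.card_univ, Finset.card_eq_sum_card_fiberwise (f := φ) (t := univ) (by simp)]
    simp [hfib]
  have hsum : ∑ g, f (φ g) = (#{g | φ g = 1} : R) * ∑ h, f h := by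
    rw [← Finset.sum_fiberwise univ φ, Finset.mul_sum]
    refine Finset.sum_congr rfl fun h _ => ?_
    rw [Finset.sum_congr rfl (g := fun _ => f h) (by simp +contextual)]
    simp [hfib]
  rw [hsum, hcard]
  push_cast
  ring

theorem AddMonoidHom.card_mul_sum_comp {G H R : Type*} [AddGroup G] [AddGroup H] [Fintype G]
    [Fintype H] [CommSemiring R] (φ : G →+ H) (hφ : Function.Surjective φ) (f : H → R) :
    (Fintype.card H : R) * ∑ g, f (φ g) = Fintype.card G * ∑ h, f h := by
  have h := MonoidHom.card_mul_sum_comp (AddMonoidHom.toMultiplicative φ) hφ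
    (f ∘ Multiplicative.toAdd)
  rw [Fintype.card_multiplicative, Fintype.card_multiplicative, ← Multiplicative.ofAdd.sum_comp,
    ← Multiplicative.ofAdd.sum_comp] at h
  exact h

/-- A subset of a group that is stable under right multiplication by a subgroup has cardinality
divisible by the order of the subgroup. -/
theorem Subgroup.card_dvd_ncard_of_mul_mem {G : Type*} [Group G] (H : Subgroup G) (s : Set G)
    (hs : ∀ x ∈ s, ∀ h ∈ H, x * h ∈ s) : Nat.card H ∣ s.ncard := by
  have h : (QuotientGroup.mk : G → G ⧸ H) ⁻¹' (QuotientGroup.mk '' s) = s := by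
    refine Set.Subset.antisymm ?_ (Set.subset_preimage_image _ _)
    rintro x ⟨y, hy, hxy⟩
    have := hs y hy _ (QuotientGroup.eq.1 hxy)
    simpa using this
  rw [← Nat.card_coe_set_eq, ← h, Nat.card_congr (QuotientGroup.preimageMkEquivSubgroupProdSet H _),
    Nat.card_prod]
  exact dvd_mul_right _ _

/-- The image of the `A`-th power map lies in the kernel of the `B`-th power map, and both have
order `B`. -/
theorem IsCyclic.exists_pow_eq_of_pow_eq_one {G : Type*} [CommGroup G] [IsCyclic G] [Finite G]
    {A B : ℕ} (hAB : Nat.card G = A * B) {x : G} (hx : x ^ B = 1) : ∃ y, y ^ A = x := by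
  have hpos : 0 < A * B := hAB ▸ Nat.card_pos
  have hle : (powMonoidHom A : G →* G).range ≤ (powMonoidHom B : G →* G).ker := by
    rintro _ ⟨y, rfl⟩
    simp [MonoidHom.mem_ker, ← pow_mul, ← hAB]
  have hc : Nat.card (powMonoidHom B : G →* G).ker ≤ Nat.card (powMonoidHom A : G →* G).range := by
    rw [IsCyclic.card_powMonoidHom_ker, IsCyclic.card_powMonoidHom_range, hAB,
      Nat.gcd_eq_right (Dvd.intro_left _ rfl), Nat.gcd_eq_right (Dvd.intro _ rfl)]
    rw [Nat.mul_div_cancel_left _ (Nat.pos_of_mul_pos_right hpos)]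
  have := Subgroup.eq_of_le_of_card_ge hle hc
  have hx' : x ∈ (powMonoidHom B : G →* G).ker := hx
  rw [← this] at hx'
  exact hx'

theorem IsCyclic.ncard_pow_eq_one {G : Type*} [CommGroup G] [IsCyclic G] [Finite G]
    {B : ℕ} (hB : B ∣ Nat.card G) : {x : G | x ^ B = 1}.ncard = B := by
  have := IsCyclic.card_powMonoidHom_ker (G := G) B
  rw [Nat.gcd_eq_right hB] at this
  exact this

/-! ### The trace character and monomial exponential sums. -/

section Char

variable (p : ℕ) [Fact p.Prime] (F : Type*) [Field F] [Algebra (ZMod p) F]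

/-- The canonical complex-valued additive character of a finite field of characteristic `p`. -/
noncomputable def traceChar : AddChar F ℂ :=
  (ZMod.stdAddChar (N := p)).compAddMonoidHom (Algebra.trace (ZMod p) F).toAddMonoidHom

/-- The exponential sum attached to the monomial `b * y ^ n`. -/
noncomputable def monomialSum {F : Type*} [Field F] [Fintype F] [Algebra (ZMod p) F]
    (n : ℕ) (b : F) : ℂ :=
  ∑ y : F, traceChar p F (b * y ^ n)

variable {F}

theorem traceChar_apply (x : F) :
    traceChar p F x = ZMod.stdAddChar (Algebra.trace (ZMod p) F x) := rfl

theorem traceChar_pow (x : F) : traceChar p F x ^ p = 1 := by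
  have : CharP F p := charP_of_injective_algebraMap (algebraMap (ZMod p) F).injective p
  rw [← AddChar.map_nsmul_eq_pow]
  simp

/-- Such an `h` is a nonzero element of the prime field, so it factors out of the trace. -/
theorem trace_mul_ne_zero_iff {h : F} (hh : h ^ (p - 1) = 1) (x : F) :
    Algebra.trace (ZMod p) F (x * h) ≠ 0 ↔ Algebra.trace (ZMod p) F x ≠ 0 := by
  have hfix : h ^ p = h := by
    conv_lhs => rw [← Nat.sub_add_cancel (Fact.out : p.Prime).one_le, pow_succ, hh, one_mul]
  obtain ⟨s, hs⟩ : ∃ s : ZMod p, algebraMap (ZMod p) F s = h := by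
    have : CharP F p := charP_of_injective_algebraMap (algebraMap (ZMod p) F).injective p
    exact (bot_le : (⊥ : Subfield F) ≤ (algebraMap (ZMod p) F).fieldRange)
      ((Subfield.mem_bot_iff_pow_eq_self F p).2 hfix)
  have hs0 : s ≠ 0 := by
    rintro rfl
    rw [← hs, map_zero, zero_pow (Nat.sub_ne_zero_of_lt (Fact.out : p.Prime).one_lt)] at hh
    exact zero_ne_one hh
  rw [← hs, mul_comm, ← Algebra.smul_def, map_smul, smul_eq_mul]
  simp [hs0]

variable [Fintype F]

theorem exists_trace_mul_ne_zero {c : F} (hc : c ≠ 0) :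
    ∃ x, Algebra.trace (ZMod p) F (c * x) ≠ 0 := by
  by_contra! h
  exact hc ((traceForm_nondegenerate (ZMod p) F).1 c fun x => by
    simpa [Algebra.traceForm_apply] using h x)

theorem trace_pow_char (x : F) :
    Algebra.trace (ZMod p) F (x ^ p) = Algebra.trace (ZMod p) F x := by
  have : CharP F p := charP_of_injective_algebraMap (algebraMap (ZMod p) F).injective p
  have := Algebra.trace_eq_of_algEquiv (FiniteField.frobeniusAlgEquiv (ZMod p) F p) x
  simpa [FiniteField.frobeniusAlgEquiv, ZMod.card] using this

theorem traceChar_pow_char_pow (j : ℕ) (x : F) :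
    traceChar p F (x ^ p ^ j) = traceChar p F x := by
  induction j with
  | zero => simp
  | succ k ih => rw [pow_succ, pow_mul, traceChar_apply, trace_pow_char, ← traceChar_apply, ih]

theorem isPrimitive_traceChar : (traceChar p F).IsPrimitive := by
  intro c hc h
  obtain ⟨x, hx⟩ := exists_trace_mul_ne_zero p hc
  have h1 : traceChar p F (c * x) = 1 := by
    simpa using DFunLike.congr_fun h x
  rw [traceChar_apply] at h1
  exact hx (ZMod.injective_stdAddChar (by rw [h1, AddChar.map_zero_eq_one]))

theorem conj_traceChar (x : F) : (starRingEnd ℂ) (traceChar p F x) = traceChar p F (-x) :=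
  (AddChar.map_neg_eq_conj _ _).symm

theorem monomialSum_zero (n : ℕ) : monomialSum p n (0 : F) = Fintype.card F := by
  simp [monomialSum]

theorem monomialSum_mul_pow (n : ℕ) (b : F) {v : F} (hv : v ≠ 0) :
    monomialSum p n (b * v ^ n) = monomialSum p n b := by
  unfold monomialSum
  refine Fintype.sum_equiv (Equiv.mulLeft₀ v hv) _ _ fun y => ?_
  simp [mul_pow, mul_assoc]

/-- The number of `y` with `Tr (b * y ^ n) ≠ 0`. -/
noncomputable def traceNonzeroCount {F : Type*} [Field F] [Algebra (ZMod p) F]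
    (n : ℕ) (b : F) : ℕ :=
  {y : Fˣ | Algebra.trace (ZMod p) F (b * (y : F) ^ n) ≠ 0}.ncard

theorem traceNonzeroCount_eq_card {n : ℕ} (hn : n ≠ 0) (b : F) :
    traceNonzeroCount p n b = #{y : F | Algebra.trace (ZMod p) F (b * y ^ n) ≠ 0} := by
  rw [traceNonzeroCount, ← Set.ncard_coe_finset]
  rw [← Set.ncard_image_of_injective _ (Units.val_injective (α := F))]
  congr 1
  ext y
  simp only [Set.mem_image, Set.mem_ofPred_eq, coe_filter, mem_univ, true_and]
  constructor
  · rintro ⟨u, hu, rfl⟩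
    exact hu
  · intro h
    refine ⟨Units.mk0 y ?_, h, rfl⟩
    rintro rfl
    simp [hn] at h

variable [DecidableEq F]

theorem sum_traceChar_mul (c : F) :
    ∑ x, traceChar p F (c * x) = if c = 0 then (Fintype.card F : ℂ) else 0 := by
  simpa [mul_comm] using AddChar.sum_mulShift c (isPrimitive_traceChar p (F := F))

/-- The sum over all `b` of the monomial sums. -/
theorem sum_monomialSum {n : ℕ} (hn : n ≠ 0) :
    ∑ b : F, monomialSum p n b = Fintype.card F := by
  simp_rw [monomialSum]
  rw [Finset.sum_comm]
  simp_rw [mul_comm _ (_ ^ n), sum_traceChar_mul]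
  simp [hn]

theorem sum_units_eq {R : Type*} [AddCommGroup R] (f : F → R) :
    ∑ u : Fˣ, f u = ∑ x, f x - f 0 := by
  rw [eq_sub_iff_add_eq, add_comm]
  exact (Fintype.sum_eq_add_sum_subtype_ne f 0).symm ▸ by
    congr 1
    exact Fintype.sum_equiv unitsEquivNeZero _ _ fun _ => rfl

theorem sum_units_monomialSum {n : ℕ} (hn : n ≠ 0) :
    ∑ b : Fˣ, monomialSum p n (b : F) = 0 := by
  rw [sum_units_eq (monomialSum p n), sum_monomialSum p hn, monomialSum_zero, sub_self]

theorem sum_units_traceChar_monomial {n : ℕ} (hn : n ≠ 0) (b : F) :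
    ∑ y : Fˣ, traceChar p F (b * (y : F) ^ n) = monomialSum p n b - 1 := by
  rw [sum_units_eq (fun y => traceChar p F (b * y ^ n)), monomialSum]
  simp [hn]

theorem exists_pow_eq_algebraMap {n : ℕ} (hn : n * (p - 1) ∣ Fintype.card F - 1)
    {s : ZMod p} (hs : s ≠ 0) : ∃ v : F, v ≠ 0 ∧ v ^ n = algebraMap (ZMod p) F s := by
  obtain ⟨k, hk⟩ := hn
  have hs' : algebraMap (ZMod p) F s ≠ 0 := by simpa using hs
  obtain ⟨v, hv⟩ := IsCyclic.exists_pow_eq_of_pow_eq_one (G := Fˣ) (A := n * k) (B := p - 1)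
    (by rw [Nat.card_eq_fintype_card, Fintype.card_units, hk]; ring)
    (x := Units.mk0 _ hs') (by
      ext
      simp [← map_pow, ZMod.pow_card_sub_one_eq_one hs])
  refine ⟨(v : F) ^ k, by simp, ?_⟩
  rw [← pow_mul, mul_comm k]
  simpa [Units.ext_iff] using hv

theorem sum_stdAddChar_mul (t : ZMod p) :
    ∑ s : ZMod p, ZMod.stdAddChar (s * t) = if t = 0 then (p : ℂ) else 0 := by
  simpa [ZMod.card] using AddChar.sum_mulShift t (ZMod.isPrimitive_stdAddChar p)

/-- Sum ψ(s·Tr(b y^n)) over s in F_p and y in F. Summing over s detects Tr = 0. Summing over y gives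
the same monomial sum for each s ≠ 0, because s is an n-th power. -/
theorem monomialSum_eq {n : ℕ} (hn0 : n ≠ 0) (hn : n * (p - 1) ∣ Fintype.card F - 1) (b : F) :
    (p - 1 : ℂ) * monomialSum p n b =
      (p - 1) * Fintype.card F - p * traceNonzeroCount p n b := by
  have hinv : ∀ s : ZMod p, s ≠ 0 →
      ∑ y : F, ZMod.stdAddChar (s * Algebra.trace (ZMod p) F (b * y ^ n)) =
        monomialSum p n b := by
    intro s hs
    obtain ⟨v, hv0, hv⟩ := exists_pow_eq_algebraMap (F := F) p hn hs
    rw [← monomialSum_mul_pow p n b hv0, hv]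
    unfold monomialSum
    refine Finset.sum_congr rfl fun y _ => ?_
    rw [traceChar_apply, mul_comm b (algebraMap (ZMod p) F s), mul_assoc,
      ← Algebra.smul_def, map_smul, smul_eq_mul]
  have h1 : ∑ s : ZMod p, ∑ y : F,
      (ZMod.stdAddChar (s * Algebra.trace (ZMod p) F (b * y ^ n)) : ℂ) =
        Fintype.card F + (p - 1) * monomialSum p n b := by
    rw [Fintype.sum_eq_add_sum_compl (0 : ZMod p),
      Finset.sum_congr rfl (g := fun _ => monomialSum p n b)
        (fun s hs => hinv s (by simpa using hs))]
    simp [Finset.card_compl, ZMod.card, Nat.cast_sub (Fact.out : p.Prime).one_le]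
  rw [Finset.sum_comm] at h1
  simp_rw [sum_stdAddChar_mul] at h1
  rw [traceNonzeroCount_eq_card p hn0]
  have h2 := Finset.card_filter_add_card_filter_not (s := (univ : Finset F))
    (fun y => Algebra.trace (ZMod p) F (b * y ^ n) = 0)
  rw [Finset.card_univ] at h2
  rw [← Finset.sum_filter, Finset.sum_const, nsmul_eq_mul] at h1
  have h3 : (Fintype.card F : ℂ) = _ := congrArg Nat.cast h2.symm
  push_cast at h3
  simp only [ne_eq]
  linear_combination -h1 - p * h3

/-- Multiplying y by an n(p-1)-th root of unity scales y^n by an element of F_p^×, so these roots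
act on the counted set. -/
theorem dvd_traceNonzeroCount {n : ℕ} (hn : n * (p - 1) ∣ Fintype.card F - 1) (b : F) :
    n * (p - 1) ∣ traceNonzeroCount p n b := by
  have hcard : Nat.card (powMonoidHom (n * (p - 1)) : Fˣ →* Fˣ).ker = n * (p - 1) := by
    rw [IsCyclic.card_powMonoidHom_ker, Nat.card_eq_fintype_card, Fintype.card_units]
    exact Nat.gcd_eq_right hn
  have key := Subgroup.card_dvd_ncard_of_mul_mem (powMonoidHom (n * (p - 1)) : Fˣ →* Fˣ).ker
    {y : Fˣ | Algebra.trace (ZMod p) F (b * (y : F) ^ n) ≠ 0} ?_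
  · rwa [hcard] at key
  intro x hx h hh
  have hh' : ((h : F) ^ n) ^ (p - 1) = 1 := by
    have : h ^ (n * (p - 1)) = 1 := hh
    rw [← pow_mul]
    simpa [Units.ext_iff] using this
  simp only [Set.mem_ofPred_eq, Units.val_mul, mul_pow] at hx ⊢
  rw [← mul_assoc]
  exact (trace_mul_ne_zero_iff p hh' _).2 hx

end Char

/-! ### Sums with exponent p^j + 1. -/

section Hermitian

variable (p : ℕ) [Fact p.Prime] {F : Type*} [Field F] [Fintype F]
  [DecidableEq F]

theorem card_pow_eq_self {B : ℕ} (hB : B ∣ Fintype.card F - 1) :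
    #{c : F | c ^ (B + 1) = c} = B + 1 := by
  have h1 := IsCyclic.ncard_pow_eq_one (G := Fˣ) (B := B)
    (by rwa [Nat.card_eq_fintype_card, Fintype.card_units])
  have h2 : ({c : F | c ^ (B + 1) = c} : Finset F) =
      insert 0 (({x : Fˣ | x ^ B = 1} : Finset Fˣ).map ⟨Units.val, Units.val_injective⟩) := by
    ext c
    by_cases hc : c = 0
    · simp [hc]
    · simp only [mem_filter, mem_univ, true_and, mem_insert, hc, mem_map,
        Function.Embedding.coeFn_mk, false_or]
      rw [pow_succ, mul_eq_right₀ hc]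
      constructor
      · intro h
        exact ⟨Units.mk0 c hc, by ext; simpa using h, rfl⟩
      · rintro ⟨x, hx, rfl⟩
        simpa [Units.ext_iff] using hx
  rw [h2, Finset.card_insert_of_notMem (by simp), Finset.card_map, ← Set.ncard_coe_finset]
  simpa using h1

/-- The ratio c of two nonzero solutions satisfies c^(Q²) = c with Q = p^j, so a nonzero radical is
a line over F_(Q²). -/
theorem card_radical {j : ℕ} (hj : j ≠ 0) (hd : p ^ j * p ^ j - 1 ∣ Fintype.card F - 1) {b : F}
    (hb : b ≠ 0) :
    #{w : F | b * w + b ^ p ^ j * (w ^ p ^ j) ^ p ^ j = 0} = 1 ∨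
      #{w : F | b * w + b ^ p ^ j * (w ^ p ^ j) ^ p ^ j = 0} = p ^ j * p ^ j := by
  have hQ : 2 ≤ p ^ j := (Fact.out : p.Prime).two_le.trans (Nat.le_self_pow hj p)
  by_cases h : ∃ w : F, w ≠ 0 ∧ b * w + b ^ p ^ j * (w ^ p ^ j) ^ p ^ j = 0
  · right
    obtain ⟨w, hw0, hw⟩ := h
    have hpos : 4 ≤ p ^ j * p ^ j := by nlinarith
    have hc := card_pow_eq_self (F := F) hd
    rw [Nat.sub_add_cancel (by omega)] at hc
    rw [← hc]
    symm
    refine Finset.card_bij (fun c _ => c * w) ?_ ?_ ?_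
    · intro c hc
      simp only [mem_filter, mem_univ, true_and, ← pow_mul] at hc hw ⊢
      rw [mul_pow, hc]
      linear_combination c * hw
    · intro c _ d _ h
      exact mul_right_cancel₀ hw0 h
    · intro x hx
      simp only [mem_filter, mem_univ, true_and, ← pow_mul] at hx hw ⊢
      refine ⟨x / w, ?_, div_mul_cancel₀ x hw0⟩
      rw [div_pow, div_eq_div_iff (pow_ne_zero _ hw0) hw0]
      have hbQ : b ^ p ^ j ≠ 0 := pow_ne_zero _ hb
      refine mul_left_cancel₀ hbQ ?_
      linear_combination w * hx - x * hw
  · left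
    push Not at h
    rw [Finset.card_eq_one]
    refine ⟨0, ?_⟩
    ext w
    simp only [mem_filter, mem_univ, true_and, mem_singleton]
    constructor
    · intro hw
      by_contra h0
      exact h w h0 hw
    · rintro rfl
      simp [(Fact.out : p.Prime).ne_zero]

variable [Algebra (ZMod p) F]

/-- Frobenius invariance of the trace turns the second term into b^Q z^Q w^(Q²), with Q = p^j; the
argument is then linear in z^Q, which runs over F. -/
theorem sum_traceChar_polar (j : ℕ) (b w : F) :
    ∑ z : F, traceChar p F (b * (z ^ p ^ j * w + z * w ^ p ^ j)) =
      if b * w + b ^ p ^ j * (w ^ p ^ j) ^ p ^ j = 0 then (Fintype.card F : ℂ) else 0 := by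
  have : CharP F p := charP_of_injective_algebraMap (algebraMap (ZMod p) F).injective p
  have hbij : Function.Bijective (fun z : F => z ^ p ^ j) :=
    Finite.injective_iff_bijective.1 (iterateFrobenius_inj F p j)
  rw [← sum_traceChar_mul p, 
    ← hbij.sum_comp (fun z => traceChar p F ((b * w + b ^ p ^ j * (w ^ p ^ j) ^ p ^ j) * z))]
  refine Finset.sum_congr rfl fun z _ => ?_
  rw [mul_add, AddChar.map_add_eq_mul, ← traceChar_pow_char_pow p j (b * (z * w ^ p ^ j)),
    ← AddChar.map_add_eq_mul]
  congr 1
  simp only [mul_pow]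
  ring

theorem monomialSum_mul_conj (hp : Odd p) (j : ℕ) (b : F) :
    monomialSum p (p ^ j + 1) b * (starRingEnd ℂ) (monomialSum p (p ^ j + 1) b) =
      Fintype.card F * #{w : F | b * w + b ^ p ^ j * (w ^ p ^ j) ^ p ^ j = 0} := by
  have : CharP F p := charP_of_injective_algebraMap (algebraMap (ZMod p) F).injective p
  have h1 : monomialSum p (p ^ j + 1) b * (starRingEnd ℂ) (monomialSum p (p ^ j + 1) b) =
      ∑ w : F, traceChar p F (b * w ^ (p ^ j + 1)) *
        ∑ z : F, traceChar p F (b * (z ^ p ^ j * w + z * w ^ p ^ j)) := by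
    rw [monomialSum, map_sum, Finset.sum_mul_sum, Finset.sum_comm]
    simp_rw [Finset.mul_sum]
    rw [Finset.sum_comm (s := univ) (t := univ) (f := fun w z => traceChar p F (b * w ^ (p ^ j + 1))
      * traceChar p F (b * (z ^ p ^ j * w + z * w ^ p ^ j)))]
    refine Finset.sum_congr rfl fun z _ => ?_
    rw [← Equiv.sum_comp (Equiv.addLeft z)]
    refine Finset.sum_congr rfl fun w _ => ?_
    rw [conj_traceChar, ← AddChar.map_add_eq_mul, ← AddChar.map_add_eq_mul]
    congr 1
    simp only [Equiv.coe_addLeft, pow_succ, add_pow_char_pow]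
    ring
  rw [h1]
  simp_rw [sum_traceChar_polar]
  rw [Finset.card_filter, Nat.cast_sum, Finset.mul_sum]
  refine Finset.sum_congr rfl fun w _ => ?_
  split_ifs with hw
  · have h2 : traceChar p F (b * (w ^ p ^ j * w + w * w ^ p ^ j)) = 1 := by
      have h0 : traceChar p F (b * (w ^ p ^ j * w + w * w ^ p ^ j)) =
          traceChar p F (w ^ p ^ j * (b * w + b ^ p ^ j * (w ^ p ^ j) ^ p ^ j)) := by
        rw [mul_add, AddChar.map_add_eq_mul, ← traceChar_pow_char_pow p j (b * (w * w ^ p ^ j)),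
          ← AddChar.map_add_eq_mul]
        congr 1
        simp only [mul_pow]
        ring
      rw [h0, hw, mul_zero, AddChar.map_zero_eq_one]
    -- The polar form at z = w is 2b w^(Q+1), so this value is a square root of 1. It is also a p-th
    -- root of 1 with p odd, hence 1.
    have h3 : traceChar p F (b * w ^ (p ^ j + 1)) ^ 2 = 1 := by
      rw [← AddChar.map_nsmul_eq_pow, ← h2]
      congr 1
      rw [two_nsmul]
      ring
    obtain ⟨k, hk⟩ := hp
    have h4 : traceChar p F (b * w ^ (p ^ j + 1)) ^ (2 * k + 1) = 1 := by
      rw [← hk, traceChar_pow]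
    rw [pow_succ, pow_mul, h3, one_pow, one_mul] at h4
    rw [h4]
    simp
  · simp

theorem Int.add_one_dvd_pow_sub_neg_one_pow (Q g : ℕ) : ((Q : ℤ) + 1) ∣ (Q : ℤ) ^ g - (-1) ^ g := by
  have := sub_dvd_pow_sub_pow (Q : ℤ) (-1) g
  simpa using this

/-- Modulo Q+1 one has Q ≡ -1; the wrong sign would force Q+1 to divide 2. -/
theorem Int.eq_neg_one_pow_mul_of_sq_eq {Q g : ℕ} (hQ : 2 ≤ Q) {s : ℤ} (hs : ((Q : ℤ) + 1) ∣ s - 1)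
    (h : s ^ 2 = ((Q : ℤ) ^ g) ^ 2) : s = (-1) ^ g * (Q : ℤ) ^ g := by
  have hm := Int.add_one_dvd_pow_sub_neg_one_pow Q g
  have h2 : ¬ ((Q : ℤ) + 1) ∣ 2 := fun hd => by
    have := Int.le_of_dvd (by norm_num) hd
    omega
  rcases sq_eq_sq_iff_eq_or_eq_neg.1 h with h | h <;> subst h <;>
    rcases neg_one_pow_eq_or ℤ g with e | e <;> rw [e] at hm ⊢
  · ring
  · refine (h2 ?_).elim
    have := dvd_sub hm hs
    rwa [show (Q : ℤ) ^ g - -1 - (Q ^ g - 1) = 2 by ring] at this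
  · refine (h2 ?_).elim
    have := dvd_add hm hs
    rwa [show (Q : ℤ) ^ g - 1 + (-Q ^ g - 1) = -2 by ring, dvd_neg] at this
  · ring

/-- The values of the Hermitian exponential sums. -/
theorem monomialSum_hermitian (hp : Odd p) {j g : ℕ} (hj : j ≠ 0)
    (hF : Fintype.card F = p ^ (2 * j * g)) {b : F} (hb : b ≠ 0) :
    monomialSum p (p ^ j + 1) b = (-1) ^ g * (p ^ j) ^ g ∨
      monomialSum p (p ^ j + 1) b = - ((-1) ^ g * (p ^ j) ^ (g + 1)) := by
  have hp2 := (Fact.out : p.Prime).two_le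
  have hQ : 2 ≤ p ^ j := hp2.trans (Nat.le_self_pow hj p)
  have hFQ : Fintype.card F = (p ^ j * p ^ j) ^ g := by rw [hF, ← pow_add, ← pow_mul]; ring_nf
  have hd : p ^ j * p ^ j - 1 ∣ Fintype.card F - 1 := by
    rw [hFQ]; simpa using Nat.sub_dvd_pow_sub_pow (p ^ j * p ^ j) 1 g
  have hd1 : (p ^ j + 1) * (p - 1) ∣ Fintype.card F - 1 := by
    refine dvd_trans ?_ hd
    rw [show p ^ j * p ^ j - 1 = (p ^ j + 1) * (p ^ j - 1) by
      rw [← Nat.sq_sub_sq]; simp [sq]]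
    exact mul_dvd_mul_left _ (by simpa using Nat.sub_dvd_pow_sub_pow p 1 j)
  obtain ⟨t, ht⟩ := dvd_traceNonzeroCount p hd1 b
  have h1 := monomialSum_eq p (by omega) hd1 b
  have hp1 : (p - 1 : ℂ) ≠ 0 := by
    rw [sub_ne_zero]; exact_mod_cast (by omega : p ≠ 1)
  -- The count is (Q+1)(p-1)t, so `monomialSum_eq` makes the sum an integer congruent to q, hence to
  -- 1, modulo Q+1.
  set s : ℤ := Fintype.card F - p * (p ^ j + 1) * t with hs
  have hS : monomialSum p (p ^ j + 1) b = s := by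
    refine mul_left_cancel₀ hp1 ?_
    rw [h1, ht, hs]
    push_cast [Nat.cast_sub (show 1 ≤ p by omega)]
    ring
  have hmod : ((p ^ j : ℕ) : ℤ) + 1 ∣ s - 1 := by
    have h := Int.add_one_dvd_pow_sub_neg_one_pow (p ^ j) (2 * g)
    have e : s - 1 = (((p ^ j : ℕ) : ℤ) ^ (2 * g) - (-1) ^ (2 * g)) -
        (((p ^ j : ℕ) : ℤ) + 1) * (p * t) := by
      rw [hs, hFQ, pow_mul (-1 : ℤ)]
      push_cast
      ring
    rw [e]
    exact dvd_sub h (dvd_mul_right _ _)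
  have h2 := monomialSum_mul_conj p hp j b
  rw [hS, map_intCast] at h2
  rcases card_radical p hj hd hb with h | h <;> rw [h] at h2
  · left
    have h3 : s ^ 2 = (((p ^ j : ℕ) : ℤ) ^ g) ^ 2 := by
      have : s * s = (Fintype.card F : ℤ) * (1 : ℕ) := by exact_mod_cast h2
      rw [sq, this, hFQ]
      push_cast
      ring
    rw [hS, Int.eq_neg_one_pow_mul_of_sq_eq hQ hmod h3]
    push_cast
    rfl
  · right
    have h3 : s ^ 2 = (((p ^ j : ℕ) : ℤ) ^ (g + 1)) ^ 2 := by
      have : s * s = (Fintype.card F : ℤ) * (p ^ j * p ^ j : ℕ) := by exact_mod_cast h2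
      rw [sq, this, hFQ]
      push_cast
      ring
    rw [hS, Int.eq_neg_one_pow_mul_of_sq_eq hQ hmod h3]
    push_cast
    ring

end Hermitian

/-! ### Sums whose exponent divides p^j + 1. -/

section Semiprimitive

variable (p : ℕ) [Fact p.Prime] {F : Type*} [Field F] [Fintype F] [DecidableEq F]

theorem card_coset_pow {n : ℕ} (hn : n ∣ Fintype.card F - 1) (b : Fˣ) :
    n * #{a : Fˣ | ∃ u, a = b * u ^ n} = Fintype.card Fˣ := by
  have h1 : Nat.card (powMonoidHom n : Fˣ →* Fˣ).range = Fintype.card Fˣ / n := by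
    rw [IsCyclic.card_powMonoidHom_range, Nat.card_eq_fintype_card, Fintype.card_units,
      Nat.gcd_eq_right hn]
  have h2 : #{a : Fˣ | ∃ u, a = b * u ^ n} = Nat.card (powMonoidHom n : Fˣ →* Fˣ).range := by
    rw [← Set.ncard_coe_finset, ← SetLike.coe_sort_coe, Nat.card_coe_set_eq,
      ← Set.ncard_image_of_injective ((powMonoidHom n : Fˣ →* Fˣ).range : Set Fˣ)
        (mul_right_injective b)]
    congr 1
    ext a
    simp only [coe_filter, mem_univ, true_and, Set.mem_ofPred_eq, Set.mem_image, SetLike.mem_coe,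
      MonoidHom.mem_range, powMonoidHom_apply]
    constructor
    · rintro ⟨u, rfl⟩
      exact ⟨_, ⟨u, rfl⟩, rfl⟩
    · rintro ⟨_, ⟨u, rfl⟩, rfl⟩
      exact ⟨u, rfl⟩
  rw [h2, h1, Nat.mul_div_cancel']
  rwa [Fintype.card_units]

variable [Algebra (ZMod p) F]

/-- For fixed z, replacing u by u z^k shows that Σ_u χ(a u^n z^(nk)) does not depend on z. -/
theorem card_mul_monomialSum {n k : ℕ} (hn : n ≠ 0) (hk : k ≠ 0) (a : Fˣ) :
    (Fintype.card Fˣ : ℂ) * monomialSum p n (a : F) =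
      ∑ u : Fˣ, monomialSum p (n * k) ((a * u ^ n : Fˣ) : F) := by
  have h1 : ∑ u : Fˣ, (monomialSum p (n * k) ((a * u ^ n : Fˣ) : F) - 1) =
      ∑ _z : Fˣ, (monomialSum p n (a : F) - 1) := by
    simp_rw [← sum_units_traceChar_monomial p hn, ← sum_units_traceChar_monomial p
      (mul_ne_zero hn hk)]
    rw [Finset.sum_comm]
    refine Finset.sum_congr rfl fun z _ => ?_
    refine Fintype.sum_equiv (Equiv.mulRight (z ^ k)) _ _ fun u => ?_
    congr 1
    push_cast [Equiv.coe_mulRight]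
    rw [mul_pow, ← pow_mul, mul_comm k n, mul_assoc]
  simp only [Finset.sum_sub_distrib, Finset.sum_const, Finset.card_univ, nsmul_eq_mul] at h1
  linear_combination -h1

/-- The values of the exponential sums of a monomial whose exponent divides `p ^ j + 1`. -/
theorem monomialSum_semiprimitive (hp : Odd p) {j g n : ℕ} (hj : j ≠ 0)
    (hF : Fintype.card F = p ^ (2 * j * g)) (hn : n ∣ p ^ j + 1) :
    ∃ b : Fˣ, ∀ a : Fˣ, monomialSum p n (a : F) =
      if ∃ u, a = b * u ^ n then -(((n : ℂ) - 1) * ((-1) ^ g * ((p : ℂ) ^ j) ^ g))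
      else (-1) ^ g * ((p : ℂ) ^ j) ^ g := by
  have hp0 : p ≠ 0 := (Fact.out : p.Prime).ne_zero
  set T : ℂ := (-1) ^ g * (p ^ j) ^ g with hT
  have hT0 : T ≠ 0 := by simp [hT, hp0]
  obtain ⟨k, hk⟩ := hn
  have hn0 : n ≠ 0 := by rintro rfl; simp at hk
  have hk0 : k ≠ 0 := by rintro rfl; simp at hk
  have hd : p ^ j + 1 ∣ Fintype.card F - 1 := by
    refine dvd_trans ?_ (show p ^ j * p ^ j - 1 ∣ _ from ?_)
    · exact ⟨p ^ j - 1, by rw [← Nat.sq_sub_sq]; simp [sq]⟩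
    · rw [show Fintype.card F = (p ^ j * p ^ j) ^ g by rw [hF, ← pow_add, ← pow_mul]; ring_nf]
      simpa using Nat.sub_dvd_pow_sub_pow (p ^ j * p ^ j) 1 g
  have hnd : n ∣ Fintype.card F - 1 := (Dvd.intro _ hk.symm).trans hd
  have hval : ∀ b : Fˣ, monomialSum p (p ^ j + 1) (b : F) = T ∨
      monomialSum p (p ^ j + 1) (b : F) = -(p ^ j * T) := by
    intro b
    rcases monomialSum_hermitian p hp hj hF b.ne_zero with h | h
    · exact Or.inl h
    · right
      rw [h, hT]
      ring
  have hneg : T ≠ -(p ^ j * T) := by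
    intro h
    have : ((p : ℂ) ^ j + 1) * T = 0 := by linear_combination h
    exact (mul_ne_zero (by exact_mod_cast (Nat.succ_ne_zero (p ^ j))) hT0) this
  -- the set of exceptional coefficients
  have hcardSp : (p ^ j + 1) * #{b : Fˣ | monomialSum p (p ^ j + 1) (b : F) ≠ T} =
      Fintype.card Fˣ := by
    have h0 := sum_units_monomialSum p (F := F) (n := p ^ j + 1) (by omega)
    have h1 : ∀ b : Fˣ, monomialSum p (p ^ j + 1) (b : F) =
        T - if monomialSum p (p ^ j + 1) (b : F) ≠ T then (p ^ j + 1) * T else 0 := by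
      intro b
      rcases hval b with h | h
      · simp [h]
      · rw [if_pos (by rw [h]; exact hneg.symm), h]
        ring
    rw [Finset.sum_congr rfl fun b _ => h1 b, Finset.sum_sub_distrib, ← Finset.sum_filter] at h0
    simp only [Finset.sum_const, Finset.card_univ, nsmul_eq_mul] at h0
    have h2 : (((p ^ j + 1) * #{b : Fˣ | monomialSum p (p ^ j + 1) (b : F) ≠ T} : ℕ) : ℂ) =
        (Fintype.card Fˣ : ℕ) := by
      refine mul_right_cancel₀ hT0 ?_
      push_cast
      linear_combination -h0
    exact_mod_cast h2
  obtain ⟨b, hb⟩ : ∃ b : Fˣ, monomialSum p (p ^ j + 1) (b : F) ≠ T := by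
    by_contra! h
    simp only [h, ne_eq, not_true_eq_false, filter_false, card_empty, mul_zero] at hcardSp
    exact Fintype.card_ne_zero hcardSp.symm
  -- The exceptional set contains the coset of `b` and has the same cardinality.
  have hSp : ({a : Fˣ | ∃ u, a = b * u ^ (p ^ j + 1)} : Finset Fˣ) =
      ({b : Fˣ | monomialSum p (p ^ j + 1) (b : F) ≠ T} : Finset Fˣ) := by
    refine Finset.eq_of_subset_of_card_le ?_ ?_
    · intro a ha
      simp only [mem_filter, mem_univ, true_and] at ha ⊢
      obtain ⟨u, rfl⟩ := ha
      rw [Units.val_mul, Units.val_pow_eq_pow_val, monomialSum_mul_pow _ _ _ u.ne_zero]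
      exact hb
    · exact Nat.le_of_mul_le_mul_left (hcardSp.trans (card_coset_pow hd b).symm).le
        (Nat.succ_pos _)
  -- Outside b·(n-th powers) no a u^n is exceptional, so the average is `T`.
  have hout : ∀ a : Fˣ, (¬ ∃ u, a = b * u ^ n) → monomialSum p n (a : F) = T := by
    intro a ha
    have h := card_mul_monomialSum p hn0 hk0 a
    rw [← hk, Finset.sum_congr rfl (g := fun _ => T)] at h
    · simp only [Finset.sum_const, Finset.card_univ, nsmul_eq_mul] at h
      exact mul_left_cancel₀ (by simp) h
    · intro u _
      by_contra hu
      have hmem : a * u ^ n ∈ ({a : Fˣ | ∃ u, a = b * u ^ (p ^ j + 1)} : Finset Fˣ) := by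
        rw [hSp]
        simpa using hu
      obtain ⟨v, hv⟩ := by simpa only [mem_filter, mem_univ, true_and] using hmem
      refine ha ⟨v ^ k * u⁻¹, ?_⟩
      rw [mul_pow, ← pow_mul, mul_comm k, ← hk, ← mul_assoc, ← hv, inv_pow, mul_inv_cancel_right]
  have hin : ∀ u : Fˣ, monomialSum p n ((b * u ^ n : Fˣ) : F) = monomialSum p n (b : F) := by
    intro u
    rw [Units.val_mul, Units.val_pow_eq_pow_val, monomialSum_mul_pow _ _ _ u.ne_zero]
  -- The vanishing of the sum over all units forces the remaining value.
  have hv : monomialSum p n (b : F) = -((n - 1) * T) := by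
    have h0 := sum_units_monomialSum p (F := F) hn0
    have h1 : ∀ a : Fˣ, monomialSum p n (a : F) =
        T + if ∃ u, a = b * u ^ n then monomialSum p n (b : F) - T else 0 := by
      intro a
      split_ifs with h
      · obtain ⟨u, rfl⟩ := h
        rw [hin]
        ring
      · rw [hout a h, add_zero]
    rw [Finset.sum_congr rfl fun b _ => h1 b, Finset.sum_add_distrib, ← Finset.sum_filter] at h0
    simp only [Finset.sum_const, Finset.card_univ, nsmul_eq_mul] at h0
    have hc := card_coset_pow hnd b
    have hc0 : (#{a : Fˣ | ∃ u, a = b * u ^ n} : ℂ) ≠ 0 := by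
      intro h
      rw [Nat.cast_eq_zero] at h
      rw [h, mul_zero] at hc
      exact Fintype.card_ne_zero hc.symm
    rw [← hc] at h0
    push_cast at h0
    refine mul_left_cancel₀ hc0 ?_
    linear_combination h0
  refine ⟨b, fun a => ?_⟩
  split_ifs with h
  · obtain ⟨u, rfl⟩ := h
    rw [hin, hv]
  · exact hout a h

/-- The minimum of `traceNonzeroCount` over nonzero coefficients is attained on a coset of the
`n`-th powers. -/
theorem exists_traceNonzeroCount_minimal (hp : Odd p) {j g n : ℕ} (hj : j ≠ 0)
    (hF : Fintype.card F = p ^ (2 * j * g)) (hn : n ∣ p ^ j + 1) (hn2 : 2 ≤ n)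
    (hnd : n * (p - 1) ∣ Fintype.card F - 1) :
    ∃ b : Fˣ,
      (∀ u : Fˣ, (p : ℤ) * traceNonzeroCount p n ((b * u ^ n : Fˣ) : F) =
        (p - 1) * (Fintype.card F - (if Even g then 1 else (n : ℤ) - 1) * (p ^ j) ^ g)) ∧
      ∀ a : Fˣ, (p - 1) * (Fintype.card F - (if Even g then 1 else (n : ℤ) - 1) * (p ^ j) ^ g) ≤
        (p : ℤ) * traceNonzeroCount p n (a : F) := by
  have hp1 := (Fact.out : p.Prime).one_le
  obtain ⟨b, hb⟩ := monomialSum_semiprimitive p hp hj hF hn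
  have hcount : ∀ a : Fˣ, (p : ℤ) * traceNonzeroCount p n (a : F) =
      (p - 1) * (Fintype.card F - if ∃ u, a = b * u ^ n then
        -(((n : ℤ) - 1) * ((-1) ^ g * (p ^ j) ^ g)) else (-1) ^ g * (p ^ j) ^ g) := by
    intro a
    have h1 := monomialSum_eq p (by omega) hnd (a : F)
    rw [hb a] at h1
    have h2 : (((p : ℤ) * traceNonzeroCount p n (a : F) : ℤ) : ℂ) =
        (((p - 1) * (Fintype.card F - if ∃ u, a = b * u ^ n then
        -(((n : ℤ) - 1) * ((-1) ^ g * (p ^ j) ^ g)) else (-1) ^ g * (p ^ j) ^ g) : ℤ) : ℂ) := by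
      push_cast
      linear_combination h1
    exact_mod_cast h2
  have hp1' : (0 : ℤ) ≤ p - 1 := by omega
  have hQ : (0 : ℤ) ≤ (p ^ j) ^ g := by positivity
  have hn1 : (1 : ℤ) ≤ (n : ℤ) - 1 := by omega
  rcases Nat.even_or_odd g with he | ho
  -- For even g the generic value is positive and hence the larger one; any non-exceptional coset
  -- works, and n ≥ 2 provides one. For odd g the exceptional coset is the minimizing one.
  · simp only [he.neg_one_pow, one_mul] at hcount
    simp only [he, if_true, one_mul]
    obtain ⟨c, hc⟩ : ∃ c : Fˣ, ¬ ∃ u, c = b * u ^ n := by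
      by_contra! h
      have h3 := card_coset_pow (F := F) ((dvd_mul_right _ _).trans hnd) b
      rw [Finset.filter_true_of_mem (fun x _ => h x), Finset.card_univ] at h3
      have : 0 < Fintype.card Fˣ := Fintype.card_pos
      nlinarith
    refine ⟨c, fun u => ?_, fun a => ?_⟩
    · rw [hcount, if_neg]
      rintro ⟨v, hv⟩
      exact hc ⟨v * u⁻¹, by rw [mul_pow, ← mul_assoc, ← hv, inv_pow, mul_inv_cancel_right]⟩
    · rw [hcount]
      refine mul_le_mul_of_nonneg_left ?_ hp1'
      split_ifs <;> nlinarith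
  · simp only [ho.neg_one_pow] at hcount
    simp only [Nat.not_even_iff_odd.2 ho, if_false]
    refine ⟨b, fun u => ?_, fun a => ?_⟩
    · rw [hcount, if_pos ⟨u, rfl⟩]
      ring
    · rw [hcount]
      refine mul_le_mul_of_nonneg_left ?_ hp1'
      split_ifs <;> nlinarith

end Semiprimitive

/-! ### From codeword weights to the exponent N₁. -/

section GcdReduction

variable (p : ℕ) [Fact p.Prime] {F : Type*} [Field F] [Fintype F] [DecidableEq F]
  [Algebra (ZMod p) F]

theorem traceNonzeroCount_eq_sum (n : ℕ) (b : F) :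
    traceNonzeroCount p n b =
      ∑ y : Fˣ, if Algebra.trace (ZMod p) F (b * ((y ^ n : Fˣ) : F)) ≠ 0 then 1 else 0 := by
  rw [traceNonzeroCount, ← Finset.card_filter, ← Set.ncard_coe_finset]
  simp

/-- With N = Ad and N' = Bd, the map (y, z) ↦ y^A z^B is onto by Bézout. Its d-th power is y^N z^N',
and z^N' lies in F_p^×. -/
theorem traceNonzeroCount_gcd {N N' : ℕ} (hN' : N' * (p - 1) = Fintype.card F - 1)
    (b : F) : traceNonzeroCount p (N.gcd N') b = traceNonzeroCount p N b := by
  obtain ⟨A, B, hAB, hA, hB⟩ := Nat.exists_coprime N N'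
  set d := N.gcd N' with hd
  have hsurj : Function.Surjective (fun x : Fˣ × Fˣ => x.1 ^ A * x.2 ^ B) := by
    intro w
    refine ⟨(w ^ A.gcdA B, w ^ A.gcdB B), ?_⟩
    have := Nat.gcd_eq_gcd_ab A B
    rw [hAB.gcd_eq_one] at this
    simp only
    rw [← zpow_natCast, ← zpow_natCast, ← zpow_mul, ← zpow_mul, ← zpow_add, mul_comm _ (A : ℤ),
      mul_comm _ (B : ℤ), ← this]
    simp
  let φ : Fˣ × Fˣ →* Fˣ :=
    { toFun := fun x => x.1 ^ A * x.2 ^ B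
      map_one' := by simp
      map_mul' := fun x y => by
        simp only [Prod.fst_mul, Prod.snd_mul, mul_pow]
        exact mul_mul_mul_comm _ _ _ _ }
  let f : Fˣ → ℕ := fun x => if Algebra.trace (ZMod p) F (b * ((x ^ d : Fˣ) : F)) ≠ 0 then 1 else 0
  have h := MonoidHom.card_mul_sum_comp φ hsurj f
  have hf : ∀ y z : Fˣ, f (φ (y, z)) =
      if Algebra.trace (ZMod p) F (b * ((y ^ N : Fˣ) : F)) ≠ 0 then 1 else 0 := by
    intro y z
    have e : φ (y, z) ^ d = y ^ N * z ^ N' := by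
      change (y ^ A * z ^ B) ^ d = _
      rw [mul_pow, ← pow_mul, ← pow_mul, ← hA, ← hB]
    have e2 : ((z ^ N' : Fˣ) : F) ^ (p - 1) = 1 := by
      rw [← Units.val_pow_eq_pow_val, ← pow_mul, hN', ← Fintype.card_units, pow_card_eq_one,
        Units.val_one]
    simp only [f, e]
    rw [Units.val_mul, ← mul_assoc, if_congr (trace_mul_ne_zero_iff p e2 _) rfl rfl]
  rw [Fintype.sum_prod_type] at h
  simp only [hf, Finset.sum_const, Finset.card_univ, smul_eq_mul, ← Finset.mul_sum,
    Fintype.card_prod, Nat.cast_id] at h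
  rw [← traceNonzeroCount_eq_sum, ← traceNonzeroCount_eq_sum, ← mul_assoc] at h
  exact (Nat.eq_of_mul_eq_mul_left (by positivity) h).symm

theorem Finset.sum_range_mul_of_periodic {M : Type*} [AddCommMonoid M] {g : ℕ → M} {n : ℕ}
    (hg : Function.Periodic g n) (N : ℕ) :
    ∑ l ∈ range (N * n), g l = N • ∑ l ∈ range n, g l := by
  induction N with
  | zero => simp
  | succ k ih =>
    rw [add_mul, one_mul, Finset.sum_range_add, ih, succ_nsmul]
    congr 1
    refine Finset.sum_congr rfl fun l _ => ?_
    have := hg.nat_mul k l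
    rw [add_comm]
    simpa using this

/-- Writing y = α^l, the element y^N depends only on l modulo n, and l runs through `N` periods. -/
theorem mul_card_filter_eq_traceNonzeroCount {α : Fˣ} (hα : ∀ x : Fˣ, x ∈ Subgroup.zpowers α)
    {N n : ℕ} (hNn : N * n = Fintype.card F - 1) (a : F) :
    N * #{i : Fin n | Algebra.trace (ZMod p) F (a * ((α : F) ^ N) ^ (i : ℕ)) ≠ 0} =
      traceNonzeroCount p N a := by
  have hord : orderOf α = N * n := by
    rw [orderOf_eq_card_of_forall_mem_zpowers hα, Nat.card_eq_fintype_card, Fintype.card_units, hNn]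
  let f : Fˣ → ℕ := fun y => if Algebra.trace (ZMod p) F (a * ((y ^ N : Fˣ) : F)) ≠ 0 then 1 else 0
  have h1 : ∑ y : Fˣ, f y = ∑ l ∈ range (N * n), f (α ^ l) := by
    rw [← IsCyclic.image_range_orderOf hα, Finset.sum_image, hord]
    intro x hx y hy hxy
    exact pow_injOn_Iio_orderOf (by simpa using hx) (by simpa using hy) hxy
  have hper : Function.Periodic (fun l => f (α ^ l)) n := by
    intro l
    have : (α ^ (l + n)) ^ N = (α ^ l) ^ N := by
      rw [pow_add, mul_pow, ← pow_mul α n, mul_comm n, ← hord, pow_orderOf_eq_one, mul_one]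
    simp only [f, this]
  rw [traceNonzeroCount_eq_sum, Finset.card_filter, 
    show (∑ y : Fˣ, if Algebra.trace (ZMod p) F (a * ((y ^ N : Fˣ) : F)) ≠ 0 then 1 else 0) = _
      from h1, Finset.sum_range_mul_of_periodic hper, smul_eq_mul, Finset.sum_range]
  congr 1
  refine Finset.sum_congr rfl fun i _ => ?_
  simp only [f, Units.val_pow_eq_pow_val, ← pow_mul, mul_comm N]

end GcdReduction

/-! ### Supports, total weights and generalized Hamming weights. -/

section Code

/-- A coordinate functional on `U` is either zero or onto `K`; in the latter case it is nonzero on a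
proportion (|K|-1)/|K| of `U`. -/
theorem ncard_codeSupport_mul {K ι : Type*} [Field K] [Fintype K] [DecidableEq K] [Fintype ι]
    (U : Submodule K (ι → K)) [Fintype U] :
    (codeSupport U).ncard * ((Fintype.card K - 1) * Fintype.card U) =
      Fintype.card K * ∑ u : U, #{i | (u : ι → K) i ≠ 0} := by
  classical
  have h1 : ∀ i, Fintype.card K * ∑ u : U, (if (u : ι → K) i ≠ 0 then 1 else 0) =
      if i ∈ codeSupport U then (Fintype.card K - 1) * Fintype.card U else 0 := by
    intro i
    split_ifs with hi
    · obtain ⟨x, hx, hxi⟩ := hi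
      let L : U →ₗ[K] K := LinearMap.proj i ∘ₗ U.subtype
      have hL : Function.Surjective L.toAddMonoidHom := by
        refine LinearMap.surjective (f := L) fun h => hxi ?_
        simpa [L] using LinearMap.congr_fun h ⟨x, hx⟩
      have h := AddMonoidHom.card_mul_sum_comp L.toAddMonoidHom hL
        (fun t => if t ≠ 0 then (1 : ℕ) else 0)
      simp only [Nat.cast_id] at h
      refine h.trans ?_
      rw [← Finset.card_filter, Finset.filter_ne' univ (0 : K), Finset.card_erase_of_mem (mem_univ _),
        Finset.card_univ, mul_comm]
    · have : ∀ u : U, (u : ι → K) i = 0 := fun u => by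
        by_contra h
        exact hi ⟨u, u.2, h⟩
      simp [this]
  simp_rw [Finset.card_filter]
  rw [Finset.sum_comm, Finset.mul_sum, Finset.sum_congr rfl fun i _ => h1 i, ← Finset.sum_filter,
    Finset.sum_const, smul_eq_mul, ← Set.ncard_coe_finset]
  simp

/-- If the minimum weight of a linear code, given as the image of an injective linear map, is the
weight of all nonzero words of an `r`-dimensional subcode, then that subcode attains the `r`-th
generalized Hamming weight. -/
theorem generalizedHammingWeight_of_constant_weight {K ι V : Type*} [Field K] [Fintype K]
    [DecidableEq K] [Fintype ι] [AddCommGroup V] [Module K V] [FiniteDimensional K V]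
    (c : V →ₗ[K] (ι → K)) (hc : Function.Injective c) (W : ℝ)
    (hW : ∀ a ≠ 0, W ≤ #{i | c a i ≠ 0})
    (H : Submodule K V) (hH : ∀ a ∈ H, a ≠ 0 → (#{i | c a i ≠ 0} : ℝ) = W) :
    Module.finrank K H ≤ Module.finrank K (LinearMap.range c) ∧
    (generalizedHammingWeight (LinearMap.range c) (Module.finrank K H) : ℝ) *
        ((Fintype.card K - 1) * Fintype.card K ^ Module.finrank K H) =
      Fintype.card K * ((Fintype.card K ^ Module.finrank K H - 1) * W) := by
  classical
  have hK1 : 1 < Fintype.card K := Fintype.one_lt_card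
  have hsum : ∀ (U : Submodule K (ι → K)) [Fintype U],
      ((codeSupport U).ncard : ℝ) * ((Fintype.card K - 1) *
        Fintype.card K ^ Module.finrank K U) =
      Fintype.card K * ∑ u ∈ univ.erase (0 : U), (#{i | (u : ι → K) i ≠ 0} : ℝ) := by
    intro U _
    have h := ncard_codeSupport_mul U
    rw [Module.card_eq_pow_finrank (K := K) (V := U)] at h
    have h2 := congrArg (Nat.cast : ℕ → ℝ) h
    rw [← Finset.sum_erase_add _ _ (mem_univ (0 : U))] at h2
    push_cast [Nat.cast_sub hK1.le] at h2
    simpa using h2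
  have hcard : ∀ (U : Submodule K (ι → K)) [Fintype U],
      ((univ.erase (0 : U)).card : ℝ) = Fintype.card K ^ Module.finrank K U - 1 := by
    intro U _
    rw [Finset.card_erase_of_mem (mem_univ _), Finset.card_univ,
      Module.card_eq_pow_finrank (K := K) (V := U), Nat.cast_sub (Nat.one_le_pow _ _ (by omega))]
    push_cast
    rfl
  have hpos : (0 : ℝ) < (Fintype.card K - 1) * Fintype.card K ^ Module.finrank K H := by
    have : (1 : ℝ) < Fintype.card K := by exact_mod_cast hK1
    exact mul_pos (by linarith) (by positivity)
  have hU0 : Module.finrank K (H.map c) = Module.finrank K H :=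
    (Submodule.equivMapOfInjective c hc H).finrank_eq.symm
  refine ⟨hU0 ▸ Submodule.finrank_mono (LinearMap.map_le_range), ?_⟩
  have hattained : ((codeSupport (H.map c)).ncard : ℝ) *
      ((Fintype.card K - 1) * Fintype.card K ^ Module.finrank K H) =
      Fintype.card K * ((Fintype.card K ^ Module.finrank K H - 1) * W) := by
    have := Fintype.ofFinite (H.map c)
    rw [← hU0, hsum, Finset.sum_congr rfl (g := fun _ => W), Finset.sum_const, nsmul_eq_mul, hcard]
    rintro ⟨_, a, ha, rfl⟩ hne
    refine hH a ha ?_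
    rintro rfl
    simp at hne
  have hleast : IsLeast {w : ℕ | ∃ U : Submodule K (ι → K), U ≤ LinearMap.range c ∧
      Module.finrank K U = Module.finrank K H ∧ (codeSupport U).ncard = w}
      (codeSupport (H.map c)).ncard := by
    refine ⟨⟨H.map c, LinearMap.map_le_range, hU0, rfl⟩, ?_⟩
    rintro _ ⟨U, hU, hr, rfl⟩
    have := Fintype.ofFinite U
    have h2 := hsum U
    rw [hr] at h2
    have h3 : ((codeSupport (H.map c)).ncard : ℝ) ≤ (codeSupport U).ncard := by
      refine le_of_mul_le_mul_right ?_ hpos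
      rw [hattained, h2]
      refine mul_le_mul_of_nonneg_left ?_ (Nat.cast_nonneg _)
      rw [← hr, ← hcard, ← nsmul_eq_mul]
      refine Finset.card_nsmul_le_sum _ _ _ ?_
      rintro ⟨u, hu⟩ hne
      obtain ⟨a, rfl⟩ := hU hu
      refine hW a ?_
      rintro rfl
      simp at hne
    exact_mod_cast h3
  rw [generalizedHammingWeight, hleast.csInf_eq]
  exact hattained

end Code

/-! ### The subfield of order p^j and N₁-th powers. -/

section Subfield

variable (p : ℕ) [Fact p.Prime] (F : Type*) [Field F] [Algebra (ZMod p) F]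

/-- The fixed points of the `j`-th power of the Frobenius, as a subspace over the prime field. -/
def frobeniusFixed (j : ℕ) : Submodule (ZMod p) F where
  carrier := {x | x ^ p ^ j = x}
  add_mem' := by
    intro x y hx hy
    have : CharP F p := charP_of_injective_algebraMap (algebraMap (ZMod p) F).injective p
    simp only [Set.mem_ofPred_eq] at hx hy ⊢
    rw [add_pow_char_pow, hx, hy]
  zero_mem' := by simp [(Fact.out : p.Prime).ne_zero]
  smul_mem' := by
    intro s x hx
    simp only [Set.mem_ofPred_eq] at hx ⊢
    rw [smul_pow, hx, ZMod.pow_card_pow]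

variable [Fintype F] [DecidableEq F]

theorem finrank_frobeniusFixed {j : ℕ} (hd : p ^ j - 1 ∣ Fintype.card F - 1) :
    Module.finrank (ZMod p) (frobeniusFixed p F j) = j := by
  have hp := (Fact.out : p.Prime)
  have h := card_pow_eq_self (F := F) hd
  rw [Nat.sub_add_cancel (Nat.one_le_pow _ _ hp.pos)] at h
  have h2 : Nat.card (frobeniusFixed p F j) = p ^ j := by
    rw [← h, ← Set.ncard_coe_finset]
    simp only [coe_filter, mem_univ, true_and]
    rfl
  rw [Module.natCard_eq_pow_finrank (K := ZMod p), Nat.card_zmod] at h2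
  exact Nat.pow_right_injective hp.two_le h2

variable {F}

/-- Nonzero fixed points are (p^j-1)-th roots of unity in a cyclic group. -/
theorem exists_pow_eq_of_mem_frobeniusFixed {j n : ℕ}
    (hd : n * (p ^ j - 1) ∣ Fintype.card F - 1) {x : F} (hx : x ∈ frobeniusFixed p F j)
    (hx0 : x ≠ 0) : ∃ u : Fˣ, ((u ^ n : Fˣ) : F) = x := by
  have hp := (Fact.out : p.Prime)
  obtain ⟨k, hk⟩ := hd
  obtain ⟨v, hv⟩ := IsCyclic.exists_pow_eq_of_pow_eq_one (G := Fˣ) (A := n * k) (B := p ^ j - 1)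
    (by rw [Nat.card_eq_fintype_card, Fintype.card_units, hk]; ring)
    (x := Units.mk0 x hx0) (by
      ext
      have h : x ^ p ^ j = x := hx
      rw [← Nat.sub_add_cancel (Nat.one_le_pow j _ hp.pos), pow_succ, mul_eq_right₀ hx0] at h
      simpa using h)
  refine ⟨v ^ k, ?_⟩
  rw [← pow_mul, mul_comm k, hv, Units.val_mk0]

end Subfield

theorem Submodule.exists_le_finrank_eq {K V : Type*} [Field K] [AddCommGroup V] [Module K V]
    [FiniteDimensional K V] (S : Submodule K V) {r : ℕ} (hr : r ≤ Module.finrank K S) :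
    ∃ H ≤ S, Module.finrank K H = r := by
  obtain ⟨f, hf⟩ := exists_linearIndependent_of_le_finrank hr
  refine ⟨Submodule.span K (Set.range (S.subtype ∘ f)), ?_, ?_⟩
  · rw [Submodule.span_le]
    rintro _ ⟨i, rfl⟩
    exact (f i).2
  · rw [finrank_span_eq_card (hf.map' _ S.ker_subtype), Fintype.card_fin]

/-! ### The main theorem. -/

theorem mainTheorem1
    (p : ℕ) [Fact p.Prime] (hp : Odd p)
    (n₁ : ℕ) (hn₁ : 0 < n₁) (hcop : Nat.Coprime n₁ p)
    (m : ℕ) (hm : IsLeast {k : ℕ | 0 < k ∧ p ^ k ≡ 1 [MOD n₁]} m)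
    (q : ℕ) (hq : q = p ^ m)
    (F : Type*) [Field F] [Finite F] [Algebra (ZMod p) F] (hF : Nat.card F = q)
    (α : Fˣ) (hα : ∀ x : Fˣ, x ∈ Subgroup.zpowers α)
    (N : ℕ) (hN : N = (q - 1) / n₁)
    (N₁ : ℕ) (hN₁ : N₁ = Nat.gcd N ((q - 1) / (p - 1))) (hN₁3 : 3 ≤ N₁)
    (θ : F) (hθ : θ = (α : F) ^ N)
    (j : ℕ) (hj : IsLeast {k : ℕ | 0 < k ∧ N₁ ∣ p ^ k + 1} j)
    (γ : ℕ) (hγ : q = p ^ (2 * j * γ))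
    (r : ℕ) (hr : 1 ≤ r) (hrj : r ≤ j) :
    r ≤ Module.finrank (ZMod p)
        (definingSetCode (ZMod p) (fun i : Fin n₁ => θ ^ (i : ℕ))) ∧
    (generalizedHammingWeight
        (definingSetCode (ZMod p) (fun i : Fin n₁ => θ ^ (i : ℕ))) r : ℝ) =
      if Even γ then (1 - 1 / (p : ℝ) ^ r) * (((q : ℝ) - √(q : ℝ)) / (N : ℝ))
      else (1 - 1 / (p : ℝ) ^ r) * (((q : ℝ) - ((N₁ : ℝ) - 1) * √(q : ℝ)) / (N : ℝ)) := by
  classical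
  have := Fintype.ofFinite F
  have hpp := (Fact.out : p.Prime)
  obtain ⟨⟨hm0, hmod⟩, hmin⟩ := hm
  obtain ⟨⟨hj0, hdvd⟩, -⟩ := hj
  have hmj : m = 2 * j * γ := Nat.pow_right_injective hpp.two_le (hq.symm.trans hγ)
  have hγ0 : γ ≠ 0 := by rintro rfl; simp at hmj; omega
  have hcard : Fintype.card F = q := by rw [← Nat.card_eq_fintype_card, hF]
  have hcard' : Fintype.card F = p ^ (2 * j * γ) := hcard.trans hγ
  have hp1 : 0 < p - 1 := Nat.sub_pos_of_lt hpp.one_lt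
  have hQ2 : 2 ≤ p ^ j := hpp.two_le.trans (Nat.le_self_pow hj0.ne' p)
  have hqQ : q = (p ^ j * p ^ j) ^ γ := by rw [hγ, ← pow_add, ← pow_mul]; ring_nf
  have hq1 : 1 < q := by rw [hq]; exact Nat.one_lt_pow hm0.ne' hpp.one_lt
  -- divisibility relations
  have hNn : N * n₁ = q - 1 := by
    rw [hN]
    exact Nat.div_mul_cancel ((Nat.modEq_iff_dvd' hq1.le).1 (hq ▸ hmod.symm))
  have hN0 : 0 < N := Nat.pos_of_ne_zero fun h => by rw [h] at hNn; omega
  have hpq : p - 1 ∣ q - 1 := by rw [hq]; simpa using Nat.sub_dvd_pow_sub_pow p 1 m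
  have hN' : (q - 1) / (p - 1) * (p - 1) = Fintype.card F - 1 := by
    rw [hcard, Nat.div_mul_cancel hpq]
  have hN₁d : N₁ * (p - 1) ∣ Fintype.card F - 1 := by
    rw [← hN', hN₁]
    exact mul_dvd_mul_right (Nat.gcd_dvd_right _ _) _
  have hQQ : p ^ j * p ^ j - 1 = (p ^ j + 1) * (p ^ j - 1) := by
    rw [← Nat.sq_sub_sq]; simp [sq]
  have hQd : (p ^ j + 1) * (p ^ j - 1) ∣ Fintype.card F - 1 := by
    rw [← hQQ, hcard, hqQ]
    simpa using Nat.sub_dvd_pow_sub_pow (p ^ j * p ^ j) 1 γ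
  obtain ⟨b, hb, hmin_count⟩ := exists_traceNonzeroCount_minimal p hp hj0.ne' hcard' hdvd
    (by omega) hN₁d
  set T : ℤ := (if Even γ then 1 else (N₁ : ℤ) - 1) * ((p : ℤ) ^ j) ^ γ with hT
  -- weights of the codewords
  set c := traceCodeword (ZMod p) (fun i : Fin n₁ => θ ^ (i : ℕ)) with hc
  have hwt : ∀ a : F, N * #{i | c a i ≠ 0} = traceNonzeroCount p N₁ a := by
    intro a
    rw [hN₁, traceNonzeroCount_gcd p hN', ← mul_card_filter_eq_traceNonzeroCount p hα
      (hNn.trans (by rw [hcard])) a]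
    simp only [hc, traceCodeword_apply, hθ]
  -- This makes the minimum weight positive, hence the encoding injective.
  have hTq : T < q := by
    have hA2 : 2 ≤ (p ^ j) ^ γ := hQ2.trans (Nat.le_self_pow hγ0 _)
    have hqA : (q : ℤ) = ((p : ℤ) ^ j) ^ γ * ((p : ℤ) ^ j) ^ γ := by
      rw [hqQ, mul_pow]
      push_cast
      rfl
    have hA2' : (2 : ℤ) ≤ ((p : ℤ) ^ j) ^ γ := by exact_mod_cast hA2
    rw [hT, hqA]
    refine mul_lt_mul_of_pos_right ?_ (by omega)
    split_ifs with he
    · omega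
    by_contra! hle
    have hle' : (p ^ j) ^ γ + 1 ≤ N₁ := by zify; omega
    have hN₁Q : N₁ ≤ p ^ j + 1 := Nat.le_of_dvd (Nat.succ_pos _) hdvd
    -- Failure means Q^γ + 1 ≤ N₁ ≤ Q + 1, so γ = 1 and N₁ = Q + 1. As N₁ divides N and N n₁ = Q² -
    -- 1, n₁ divides Q - 1, so m ≤ j, against m = 2j.
    have hγ1 : γ = 1 := by
      have : γ ≤ 1 := (Nat.pow_le_pow_iff_right hQ2).1 (by rw [pow_one]; omega)
      omega
    subst hγ1
    rw [pow_one] at hle' hqQ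
    have hN₁e : N₁ = p ^ j + 1 := le_antisymm hN₁Q hle'
    obtain ⟨t, ht⟩ : N₁ ∣ N := hN₁ ▸ Nat.gcd_dvd_left _ _
    have hn₁d : n₁ ∣ p ^ j - 1 := by
      refine ⟨t, Nat.eq_of_mul_eq_mul_left (Nat.succ_pos (p ^ j)) ?_⟩
      rw [Nat.succ_eq_add_one, ← hQQ, ← hqQ, ← hNn, ht, hN₁e]
      ring
    have := hmin ⟨hj0, ((Nat.modEq_iff_dvd' (by omega)).2 hn₁d).symm⟩
    omega
  have hNR : (0 : ℝ) < N := by exact_mod_cast hN0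
  have hpR : (1 : ℝ) < p := by exact_mod_cast hpp.one_lt
  set W : ℝ := (p - 1) * (q - T) / (p * N) with hW
  have hWle : ∀ a : F, a ≠ 0 → W ≤ #{i | c a i ≠ 0} := by
    intro a ha
    have h1 := hmin_count (Units.mk0 a ha)
    rw [Units.val_mk0, ← hwt, hcard] at h1
    rw [hW, div_le_iff₀ (by positivity)]
    have h2 : (((p - 1) * (q - T) : ℤ) : ℝ) ≤ ((p * (N * #{i | c a i ≠ 0} : ℕ) : ℤ) : ℝ) := by
      exact_mod_cast h1
    push_cast at h2
    linarith
  have hWpos : 0 < W := by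
    have : (T : ℝ) < q := by exact_mod_cast hTq
    exact div_pos (mul_pos (by linarith) (by linarith)) (by positivity)
  have hinj : Function.Injective c := by
    rw [injective_iff_map_eq_zero]
    intro a ha
    by_contra h0
    have := hWle a h0
    simp [ha] at this
    linarith
  -- an optimal subspace
  obtain ⟨H₀, hH₀, hr₀⟩ := (frobeniusFixed p F j).exists_le_finrank_eq (r := r)
    (by rwa [finrank_frobeniusFixed p F ((dvd_mul_left _ _).trans hQd)])
  -- Multiplication by `b` moves nonzero elements of F_Q, which are N₁-th powers, into the
  -- minimizing coset.
  have hmul : Function.Injective (LinearMap.mulLeft (ZMod p) (b : F)) :=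
    mul_right_injective₀ b.ne_zero
  have hrH : Module.finrank (ZMod p) (H₀.map (LinearMap.mulLeft (ZMod p) (b : F))) = r := by
    rw [← (Submodule.equivMapOfInjective _ hmul H₀).finrank_eq, hr₀]
  obtain ⟨h1, h2⟩ := generalizedHammingWeight_of_constant_weight c hinj W hWle
    (H₀.map (LinearMap.mulLeft (ZMod p) (b : F))) (by
      rintro _ ⟨x, hx, rfl⟩ hne
      have hx0 : x ≠ 0 := by rintro rfl; simp at hne
      obtain ⟨u, rfl⟩ := exists_pow_eq_of_mem_frobeniusFixed p
        ((mul_dvd_mul_right hdvd _).trans hQd) (hH₀ hx) hx0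
      have h3 := hb u
      rw [Units.val_mul, ← hwt, hcard] at h3
      rw [hW, eq_div_iff (by positivity), LinearMap.mulLeft_apply]
      have h4 : ((p * (N * #{i | c ((b : F) * ((u ^ N₁ : Fˣ) : F)) i ≠ 0} : ℕ) : ℤ) : ℝ) =
        (((p - 1) * (q - T) : ℤ) : ℝ) := by exact_mod_cast h3
      push_cast at h4 ⊢
      linarith)
  rw [hrH, ZMod.card] at h2
  rw [hrH] at h1
  refine ⟨h1, ?_⟩
  have hsqrt : √(q : ℝ) = ((p : ℝ) ^ j) ^ γ := by
    rw [hqQ, Real.sqrt_eq_iff_mul_self_eq (by positivity) (by positivity)]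
    push_cast
    ring
  have hTR : (T : ℝ) = (if Even γ then 1 else (N₁ : ℝ) - 1) * √(q : ℝ) := by
    rw [hsqrt, hT]
    push_cast
    rfl
  have hgoal : (generalizedHammingWeight (LinearMap.range c) r : ℝ) =
      (1 - 1 / (p : ℝ) ^ r) * (((q : ℝ) - T) / N) := by
    have hpr : (0 : ℝ) < (p : ℝ) ^ r := by positivity
    refine mul_right_cancel₀ (mul_pos (sub_pos.2 hpR) hpr).ne' ?_
    rw [h2, hW]
    field_simp
  refine hgoal.trans ?_
  rw [hTR]
  split_ifs
  · rw [one_mul]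
  · rfl
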